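/- Let $\tau$ be the Ramanujan function, defined by $X\prod_{n\ge 1}(1-X^n)^{24}=\sum_{n\ge 1}\tau(n)X^n$. There are absolute constants $C>0$ and $p_0$ such that for every prime $p\ge p_0$ and every integer $\lambda$ the congruence $$\sum_{i=1}^{16}\tau(n_i)-\sum_{i=1}^{16}\tau(m_i)\equiv\lambda\pmod p$$ holds for some positive integers $n_1,m_1,\ldots,n_{16},m_{16}$ with $$\max_{1\le i\le 16}\{n_i,m_i\}\le C\,p^2\log^4 p$$ and $\gcd(n_im_i,23!)=1$ for all $1\le i\le 16$. -/

import Mathlib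

noncomputable section RamanujanTau

open scoped PowerSeries.WithPiTopology

/-- The formal power series `X ∏_{n ≥ 1} (1 - Xⁿ)²⁴` over `ℤ`. The infinite product is taken in
the topology of coefficientwise convergence, where it converges
(see `multipliable_ramanujanTau_factors`). -/
def ramanujanTauSeries : PowerSeries ℤ :=
  PowerSeries.X * ∏' n : ℕ, (1 - (PowerSeries.X : PowerSeries ℤ) ^ (n + 1)) ^ 24

/-- The Ramanujan function `τ`: the coefficients of `X ∏_{n ≥ 1} (1 - Xⁿ)²⁴ = ∑ τ(n) Xⁿ`. -/
def ramanujanTau (n : ℕ) : ℤ :=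
  PowerSeries.coeff n ramanujanTauSeries

/-- The infinite product defining `τ` converges, so that `∏'` is its actual value. -/
theorem multipliable_ramanujanTau_factors :
    Multipliable fun n : ℕ => (1 - (PowerSeries.X : PowerSeries ℤ) ^ (n + 1)) ^ 24 :=
  (PowerSeries.WithPiTopology.multipliable_one_sub_X_pow ℤ).pow 24

end RamanujanTau

/-! Let `Q` and `R` be disjoint sets of primes in `(23, L]`, with `L` of order `√p log p`, each of
size at least `40 √p`. Let `A` and `B` be the sets of differences mod `p` of values of `τ` at
integers up to `L²` composed of primes of `Q` and of `R`. By multiplicativity `(τ(n) - τ(n'))(τ(m) -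
τ(m')) = τ(nm) + τ(n'm') - τ(nm') - τ(n'm)`, with arguments at most `L⁴`. So it suffices to write
each residue as a sum of eight products from `A × B`.

`A` is large (`card_le_mul_card_tauDifferences`): either `τ` takes many values on `Q`, or many
primes share their value with another, and then `τ(q)² - τ(q²) = q¹¹` puts many 11th powers in `A`.
Once `|A||B| ≥ 3p`, averaging over dilates and a pigeonhole give the eight products
(`exists_sum_eight_mul`).

The relations for `τ` follow from `ModularForm.ramanujanTau_hecke`: `T_q Δ` is a cusp form of weight
12, hence a multiple of `Δ`. -/

/-! ### The q-expansion of the discriminant -/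

open scoped PowerSeries.WithPiTopology in
/-- The coefficients of the finite partial products eventually stabilise to `τ`. -/
theorem eventually_coeff_prod_eq_ramanujanTau (m : ℕ) :
    ∀ᶠ s : Finset ℕ in Filter.atTop,
      PowerSeries.coeff m (PowerSeries.X *
        ∏ n ∈ s, (1 - (PowerSeries.X : PowerSeries ℤ) ^ (n + 1)) ^ 24) = ramanujanTau m := by
  have h : Filter.Tendsto (fun s : Finset ℕ =>
      ∏ n ∈ s, (1 - (PowerSeries.X : PowerSeries ℤ) ^ (n + 1)) ^ 24) Filter.atTop _ :=
    multipliable_ramanujanTau_factors.hasProd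
  have h2 := ((PowerSeries.WithPiTopology.continuous_coeff ℤ m).tendsto _).comp
    (h.const_mul (PowerSeries.X : PowerSeries ℤ))
  rw [nhds_discrete, Filter.tendsto_pure] at h2
  exact h2

/-- The partial products of the discriminant as a polynomial. -/
noncomputable def discriminantPartial (R : Type*) [CommRing R] (s : Finset ℕ) : Polynomial R :=
  Polynomial.X * ∏ n ∈ s, (1 - Polynomial.X ^ (n + 1)) ^ 24

theorem tendstoLocallyUniformlyOn_iteratedDeriv {ι : Type*} {φ : Filter ι} [φ.NeBot]
    {F : ι → ℂ → ℂ} {f : ℂ → ℂ}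
    {U : Set ℂ} (hU : IsOpen U) (hF : ∀ i, Differentiable ℂ (F i))
    (hf : TendstoLocallyUniformlyOn F f φ U) (m : ℕ) :
    TendstoLocallyUniformlyOn (fun i => iteratedDeriv m (F i)) (iteratedDeriv m f) φ U := by
  induction m with
  | zero => simpa using hf
  | succ m ih =>
    simp only [iteratedDeriv_succ]
    refine ih.deriv (.of_forall fun i => ?_) hU
    exact ((hF i).contDiff (n := ⊤).differentiable_iteratedDeriv m (by simp)).differentiableOn

theorem tendstoLocallyUniformlyOn_pow {ι : Type*} {φ : Filter ι} {F : ι → ℂ → ℂ} {f : ℂ → ℂ}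
    {U : Set ℂ} (hf : TendstoLocallyUniformlyOn F f φ U) (hc : ContinuousOn f U) (k : ℕ) :
    TendstoLocallyUniformlyOn (fun i => F i ^ k) (f ^ k) φ U := by
  induction k with
  | zero =>
    simp only [pow_zero]
    intro u hu x _
    exact ⟨Set.univ, Filter.univ_mem, .of_forall fun n y _ => refl_mem_uniformity hu⟩
  | succ k ih =>
    simp only [pow_succ]
    exact ih.mul₀ hf (hc.pow k) hc

theorem tendstoLocallyUniformlyOn_discriminantPartial :
    TendstoLocallyUniformlyOn (fun s q => (discriminantPartial ℂ s).eval q)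
      (fun q => q * ∏' i : ℕ, (1 - q ^ (i + 1)) ^ 24) Filter.atTop (Metric.ball (0 : ℂ) 1) := by
  have h : TendstoLocallyUniformlyOn _ _ _ _ :=
    ModularForm.multipliableLocallyUniformlyOn_one_sub_pow.hasProdLocallyUniformlyOn
  have hc := ModularForm.differentiableOn_tprod_one_sub_pow.continuousOn
  have h24 := tendstoLocallyUniformlyOn_pow h hc 24
  have hid : TendstoLocallyUniformlyOn (fun (_ : Finset ℕ) (q : ℂ) => q) (fun q => q)
      Filter.atTop (Metric.ball (0 : ℂ) 1) := fun u hu x _ =>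
    ⟨Set.univ, Filter.univ_mem, .of_forall fun n y _ => refl_mem_uniformity hu⟩
  refine ((hid.mul₀ h24 continuousOn_id (hc.pow 24)).congr fun s q _ => ?_).congr_right
    fun q hq => ?_
  · simp [discriminantPartial, Polynomial.eval_prod, Finset.prod_pow]
  · simp only [Pi.mul_apply, Pi.pow_apply]
    rw [(ModularForm.multipliable_one_sub_pow (by simpa using hq)).tprod_pow]

theorem iteratedDeriv_polynomial_eval (P : Polynomial ℂ) (m : ℕ) :
    iteratedDeriv m (fun q => P.eval q) = fun q => (Polynomial.derivative^[m] P).eval q := by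
  induction m with
  | zero => simp
  | succ m ih =>
    ext q
    rw [iteratedDeriv_succ, ih, Polynomial.deriv, Function.iterate_succ_apply']

/-- The formal and the analytic product are limits of the same polynomials. Derivatives at `0` pass
to locally uniform limits, and along the partial products the `m`-th one is eventually `m! τ(m)`. -/
theorem coeff_qExpansion_discriminant (m : ℕ) :
    (UpperHalfPlane.qExpansion 1 ModularForm.discriminant).coeff m = (ramanujanTau m : ℂ) := by
  have hmem : (0 : ℂ) ∈ Metric.ball (0 : ℂ) 1 := Metric.mem_ball_self one_pos
  have h1 := (tendstoLocallyUniformlyOn_iteratedDeriv Metric.isOpen_ball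
    (fun s => (discriminantPartial ℂ s).differentiable)
    tendstoLocallyUniformlyOn_discriminantPartial m).tendsto_at hmem
  have h2 : iteratedDeriv m (UpperHalfPlane.cuspFunction 1 ModularForm.discriminant) 0 =
      iteratedDeriv m (fun q : ℂ => q * ∏' i : ℕ, (1 - q ^ (i + 1)) ^ 24) 0 :=
    ((ModularForm.discriminant_cuspFunction_eqOn.eventuallyEq_of_mem
      (Metric.isOpen_ball.mem_nhds hmem)).iteratedDeriv_eq m)
  have h3 : ∀ᶠ s : Finset ℕ in Filter.atTop,
      iteratedDeriv m (fun q => (discriminantPartial ℂ s).eval q) 0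
        = (m.factorial : ℂ) * (ramanujanTau m : ℂ) := by
    filter_upwards [eventually_coeff_prod_eq_ramanujanTau m] with s hs
    have h4 : (discriminantPartial ℤ s).coeff m = ramanujanTau m := by
      rw [← hs, ← Polynomial.coeff_coe]
      have hX : Polynomial.coeToPowerSeries.ringHom (R := ℤ) Polynomial.X = PowerSeries.X :=
        Polynomial.coe_X
      simp [discriminantPartial, ← Polynomial.coeToPowerSeries.ringHom_apply, map_prod, hX]
    have h5 : discriminantPartial ℂ s = (discriminantPartial ℤ s).map (Int.castRingHom ℂ) := by
      simp [discriminantPartial, Polynomial.map_prod]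
    rw [← h4, h5, iteratedDeriv_polynomial_eval]
    beta_reduce
    rw [← Polynomial.coeff_zero_eq_eval_zero,
      Polynomial.coeff_iterate_derivative]
    simp [Nat.descFactorial_self]
  rw [UpperHalfPlane.qExpansion_coeff, h2,
    tendsto_nhds_unique h1 (tendsto_const_nhds.congr' (h3.mono fun _ h => h.symm))]
  rw [inv_mul_cancel_left₀ (by exact_mod_cast m.factorial_ne_zero)]

/-! ### The Hecke operator on the discriminant -/

section HeckeOperator

open UpperHalfPlane hiding I
open Complex ModularForm
open scoped MatrixGroups Real Manifold

namespace ModularForm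

local notation "Δ" => discriminant

/-- The point `(z + b) / q` of the upper half-plane. -/
noncomputable def heckeDown (q : ℕ) (hq : 0 < q) (b : ℤ) (z : ℍ) : ℍ :=
  ⟨((z : ℂ) + b) / q, by
    have : (0 : ℝ) < q := by exact_mod_cast hq
    have h : (((z : ℂ) + b) / q).im = z.im / q := by
      rw [← ofReal_natCast, div_ofReal_im]; simp
    rw [h]; exact div_pos z.im_pos this⟩

/-- The point `q z` of the upper half-plane. -/
noncomputable def heckeUp (q : ℕ) (hq : 0 < q) (z : ℍ) : ℍ :=
  ⟨(q : ℂ) * z, by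
    have : (0 : ℝ) < q := by exact_mod_cast hq
    have h : ((q : ℂ) * z).im = q * z.im := by
      rw [← ofReal_natCast, im_ofReal_mul]; rfl
    rw [h]; exact mul_pos this z.im_pos⟩

theorem coe_heckeDown (q : ℕ) (hq : 0 < q) (b : ℤ) (z : ℍ) :
    (heckeDown q hq b z : ℂ) = ((z : ℂ) + b) / q := rfl

theorem coe_heckeUp (q : ℕ) (hq : 0 < q) (z : ℍ) : (heckeUp q hq z : ℂ) = q * z := rfl

/-- The discriminant transforms with weight `12` under integral Möbius maps of determinant one. -/
theorem discriminant_moebius (a b c d : ℤ) (h : a * d - b * c = 1) (w w' : ℍ)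
    (hw : (w' : ℂ) * (c * w + d) = a * w + b) :
    Δ w' = ((c : ℂ) * w + d) ^ 12 * Δ w := by
  let γ : SL(2, ℤ) := ⟨!![a, b; c, d], by simp [Matrix.det_fin_two, h]⟩
  have h1 := congrFun (SlashInvariantForm.slash_action_generators_SL2Z
    discriminant_S_invariant discriminant_T_invariant γ) w
  rw [SL_slash_apply] at h1
  have hd : denom γ w = (c : ℂ) * w + d := by
    rw [ModularGroup.denom_apply]; simp [γ]
  have hd0 : denom γ w ≠ 0 := denom_ne_zero _ _
  have hγ : γ • w = w' := by
    ext
    rw [UpperHalfPlane.specialLinearGroup_apply]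
    rw [hd] at hd0
    simp [γ]
    rw [← hw, mul_div_cancel_right₀ _ hd0]
  rw [hγ, hd] at h1
  rw [hd] at hd0
  rw [← h1, zpow_neg]
  field_simp

theorem discriminant_add_int (w w' : ℍ) (n : ℤ) (h : (w' : ℂ) = w + n) : Δ w' = Δ w := by
  have := discriminant_moebius 1 n 0 1 (by ring) w w' (by simp [h])
  simpa using this

theorem discriminant_neg_inv (w w' : ℍ) (h : (w' : ℂ) * w = -1) : Δ w' = (w : ℂ) ^ 12 * Δ w := by
  have := discriminant_moebius 0 (-1) 1 0 (by ring) w w' (by simp [h])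
  simpa using this

/-- The Hecke operator `T_q` applied to the discriminant. -/
noncomputable def heckeDiscriminant (q : ℕ) [Fact q.Prime] (z : ℍ) : ℂ :=
  (q : ℂ) ^ 11 * Δ (heckeUp q (Fact.out : q.Prime).pos z) +
    (q : ℂ)⁻¹ * ∑ b : ZMod q, Δ (heckeDown q (Fact.out : q.Prime).pos b.val z)

theorem discriminant_heckeDown_congr (q : ℕ) (hq : 0 < q) (z z' : ℍ) (b b' k : ℤ)
    (h : (z' : ℂ) + b' = z + b + q * k) :
    Δ (heckeDown q hq b' z') = Δ (heckeDown q hq b z) := by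
  have hq' : (q : ℂ) ≠ 0 := by exact_mod_cast hq.ne'
  apply discriminant_add_int _ _ k
  rw [coe_heckeDown, coe_heckeDown, h]
  field_simp

section

variable (q : ℕ) [Fact q.Prime]

theorem sum_heckeDown_add_one (hq : 0 < q) (z z' : ℍ) (h : (z' : ℂ) = z + 1) :
    ∑ b : ZMod q, Δ (heckeDown q hq b.val z') = ∑ b : ZMod q, Δ (heckeDown q hq b.val z) := by
  refine Eq.trans ?_ (Equiv.sum_comp (Equiv.addRight (1 : ZMod q))
    (fun b : ZMod q => Δ (heckeDown q hq b.val z)))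
  refine Finset.sum_congr rfl fun b _ => ?_
  have hdvd : ((q : ℤ) ∣ (b.val : ℤ) + 1 - ((b + 1 : ZMod q).val : ℤ)) := by
    rw [← ZMod.intCast_zmod_eq_zero_iff_dvd]; simp
  obtain ⟨k, hk⟩ := hdvd
  have hk' := congrArg (Int.cast : ℤ → ℂ) hk
  push_cast at hk'
  refine discriminant_heckeDown_congr q hq _ _ _ _ k ?_
  simp only [Equiv.coe_addRight, h, Int.cast_natCast]
  linear_combination hk'

theorem heckeDiscriminant_add_one (z z' : ℍ) (h : (z' : ℂ) = z + 1) :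
    heckeDiscriminant q z' = heckeDiscriminant q z := by
  have hq := (Fact.out : q.Prime).pos
  have e : Δ (heckeUp q hq z') = Δ (heckeUp q hq z) := by
    apply discriminant_add_int _ _ q
    rw [coe_heckeUp, coe_heckeUp, h]; push_cast; ring
  unfold heckeDiscriminant
  rw [e, sum_heckeDown_add_one q hq z z' h]

/-- Inversion exchanges the terms at `qz` and `z / q`, and permutes the terms with `b ≠ 0` by `b ↦
-b⁻¹`. -/
theorem heckeDiscriminant_neg_inv (z z' : ℍ) (h : (z' : ℂ) * z = -1) :
    heckeDiscriminant q z' = (z : ℂ) ^ 12 * heckeDiscriminant q z := by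
  have hq := (Fact.out : q.Prime).pos
  have hq' : (q : ℂ) ≠ 0 := by exact_mod_cast hq.ne'
  have hz : (z : ℂ) ≠ 0 := z.ne_zero
  have e1 : Δ (heckeUp q hq z') = ((z : ℂ) / q) ^ 12 * Δ (heckeDown q hq 0 z) := by
    have := discriminant_neg_inv (heckeDown q hq 0 z) (heckeUp q hq z') (by
      rw [coe_heckeDown, coe_heckeUp]; field_simp; push_cast; linear_combination h)
    rw [this, coe_heckeDown]; simp
  have e2 : Δ (heckeDown q hq 0 z') = (q * (z : ℂ)) ^ 12 * Δ (heckeUp q hq z) := by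
    have := discriminant_neg_inv (heckeUp q hq z) (heckeDown q hq 0 z') (by
      rw [coe_heckeDown, coe_heckeUp]; field_simp; push_cast; linear_combination h)
    rw [this, coe_heckeUp]
  have e3 : ∀ b : ZMod q, b ≠ 0 →
      Δ (heckeDown q hq b.val z') = (z : ℂ) ^ 12 * Δ (heckeDown q hq (-b⁻¹).val z) := by
    intro b hb
    have hdvd : (q : ℤ) ∣ (b.val : ℤ) * ((-b⁻¹).val : ℤ) + 1 := by
      rw [← ZMod.intCast_zmod_eq_zero_iff_dvd]; simp [hb]
    obtain ⟨k, hk⟩ := hdvd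
    have hk' := congrArg (Int.cast : ℤ → ℂ) hk
    push_cast at hk'
    -- With `b'` the representative of `-b⁻¹` and `b b' + 1 = q k`, the matrix `(b, -k; q, -b')` has
    -- determinant one.
    have := discriminant_moebius b.val (-k) q (-((-b⁻¹).val)) (by linear_combination -hk)
      (heckeDown q hq (-b⁻¹).val z) (heckeDown q hq b.val z') (by
        rw [coe_heckeDown, coe_heckeDown]
        generalize (-b⁻¹).val = c at hk'
        field_simp; push_cast
        linear_combination q * (h - hk'))
    rw [this, coe_heckeDown]
    congr 2
    generalize (-b⁻¹).val = c
    field_simp; push_cast; ring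
  have e4 : ∑ b ∈ Finset.univ.erase (0 : ZMod q), Δ (heckeDown q hq b.val z') =
      (z : ℂ) ^ 12 * ∑ b ∈ Finset.univ.erase (0 : ZMod q), Δ (heckeDown q hq b.val z) := by
    rw [Finset.mul_sum]
    refine Finset.sum_nbij' (fun b => -b⁻¹) (fun b => -b⁻¹) ?_ ?_ ?_ ?_ ?_
    · intro b; simp
    · intro b; simp
    · intro b; simp [inv_neg]
    · intro b; simp [inv_neg]
    · intro b hb; exact e3 b (Finset.ne_of_mem_erase hb)
  unfold heckeDiscriminant
  rw [← Finset.add_sum_erase _ _ (Finset.mem_univ (0 : ZMod q)),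
    ← Finset.add_sum_erase _ _ (Finset.mem_univ (0 : ZMod q)), e4, e1]
  simp only [ZMod.val_zero, Nat.cast_zero]
  rw [e2]
  field_simp
  ring

end

variable (q : ℕ)

theorem tendsto_heckeUp_atImInfty (hq : 0 < q) :
    Filter.Tendsto (heckeUp q hq) atImInfty atImInfty := by
  have hq' : (0 : ℝ) < q := by exact_mod_cast hq
  have h : (UpperHalfPlane.im ∘ heckeUp q hq) = fun z => (q : ℝ) * z.im := by
    ext z
    rw [Function.comp_apply, ← coe_im, coe_heckeUp, ← ofReal_natCast, im_ofReal_mul, coe_im]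
  rw [atImInfty, Filter.tendsto_comap_iff, h]
  exact Filter.tendsto_comap.const_mul_atTop hq'

theorem tendsto_heckeDown_atImInfty (hq : 0 < q) (b : ℤ) :
    Filter.Tendsto (heckeDown q hq b) atImInfty atImInfty := by
  have hq' : (0 : ℝ) < q := by exact_mod_cast hq
  have h : (UpperHalfPlane.im ∘ heckeDown q hq b) = fun z => z.im / (q : ℝ) := by
    ext z
    rw [Function.comp_apply, ← coe_im, coe_heckeDown, ← ofReal_natCast, div_ofReal_im]
    simp
  rw [atImInfty, Filter.tendsto_comap_iff, h]
  exact Filter.tendsto_comap.atTop_div_const hq'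

theorem hasSum_discriminant (z : ℍ) :
    HasSum (fun m : ℕ => (ramanujanTau m : ℂ) * cexp (2 * π * I * z) ^ m) (Δ z) := by
  have h := ModularForm.hasSum_qExpansion (h := 1) CuspForm.discriminant one_pos
    one_mem_strictPeriods_SL z
  simp only [CuspForm.coe_discriminant, coeff_qExpansion_discriminant] at h
  simpa [Function.Periodic.qParam] using h

theorem hasSum_heckeUp (hq : 0 < q) (z : ℍ) :
    HasSum (fun n : ℕ => (if q ∣ n then (ramanujanTau (n / q) : ℂ) else 0) *
      cexp (2 * π * I * z) ^ n) (Δ (heckeUp q hq z)) := by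
  have hinj : Function.Injective fun m : ℕ => q * m := fun a b h => Nat.eq_of_mul_eq_mul_left hq h
  rw [← hinj.hasSum_iff]
  · convert hasSum_discriminant (heckeUp q hq z) using 2 with m
    simp only [Function.comp, dvd_mul_right, if_true, Nat.mul_div_cancel_left _ hq, coe_heckeUp]
    rw [pow_mul, ← Complex.exp_nat_mul]
    ring_nf
  · intro n hn
    rw [if_neg, zero_mul]
    rintro ⟨m, rfl⟩
    exact hn ⟨m, rfl⟩

variable [Fact q.Prime]

theorem heckeDiscriminant_isZeroAtImInfty : IsZeroAtImInfty (heckeDiscriminant q) := by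
  have hq := (Fact.out : q.Prime).pos
  have h : Filter.Tendsto Δ atImInfty (nhds 0) := discriminant_isZeroAtImInfty
  have h1 := (h.comp (tendsto_heckeUp_atImInfty q hq)).const_mul ((q : ℂ) ^ 11)
  have h2 := (tendsto_finsetSum Finset.univ fun (b : ZMod q) _ =>
    h.comp (tendsto_heckeDown_atImInfty q hq b.val)).const_mul (q : ℂ)⁻¹
  have h3 := h1.add h2
  simp only [Finset.sum_const_zero, mul_zero, add_zero] at h3
  exact h3

theorem mdifferentiable_heckeDiscriminant : MDiff (heckeDiscriminant q) := by
  have hq := (Fact.out : q.Prime).pos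
  have hq' : (q : ℂ) ≠ 0 := by exact_mod_cast hq.ne'
  have hE : ∀ z ∈ upperHalfPlaneSet, DifferentiableAt ℂ (fun w => eta w ^ 24) z := fun z hz =>
    (differentiableAt_eta_of_mem_upperHalfPlaneSet hz).pow 24
  rw [UpperHalfPlane.mdifferentiable_iff]
  have key : DifferentiableOn ℂ (fun w : ℂ => (q : ℂ) ^ 11 * eta (q * w) ^ 24 +
      (q : ℂ)⁻¹ * ∑ b : ZMod q, eta ((w + ((b.val : ℤ) : ℂ)) / q) ^ 24) upperHalfPlaneSet := by
    intro z hz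
    apply DifferentiableAt.differentiableWithinAt
    apply DifferentiableAt.add
    · refine DifferentiableAt.const_mul ?_ _
      exact (hE _ (heckeUp q hq ⟨z, hz⟩).2).comp z
        (f := fun w : ℂ => (q : ℂ) * w) (by fun_prop)
    · refine DifferentiableAt.const_mul ?_ _
      refine DifferentiableAt.fun_sum fun b _ => ?_
      exact (hE _ (heckeDown q hq b.val ⟨z, hz⟩).2).comp z
        (f := fun w : ℂ => (w + ((b.val : ℤ) : ℂ)) / q) (by fun_prop)
  refine key.congr fun z hz => ?_
  simp only [Function.comp, ofComplex_apply_of_im_pos hz]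
  rfl

/-- The image of the discriminant under the Hecke operator `T_q`, as a cusp form. -/
noncomputable def heckeDiscriminantCuspForm : CuspForm 𝒮ℒ 12 :=
  have hS : heckeDiscriminant q ∣[(12 : ℤ)] ModularGroup.S = heckeDiscriminant q := by
    ext z
    rw [SL_slash_apply, ModularGroup.denom_S, heckeDiscriminant_neg_inv q z (ModularGroup.S • z) (by
      rw [modular_S_smul]
      simp [z.ne_zero])]
    have := z.ne_zero
    rw [zpow_neg]
    field_simp
  have hT : heckeDiscriminant q ∣[(12 : ℤ)] ModularGroup.T = heckeDiscriminant q := by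
    ext z
    rw [SL_slash_apply, heckeDiscriminant_add_one q z (ModularGroup.T • z) (by
      rw [modular_T_smul]; simp [add_comm])]
    rw [ModularGroup.denom_apply]
    simp [ModularGroup.T]
  { toFun := heckeDiscriminant q
    slash_action_eq' := by
      rintro A ⟨A, rfl⟩
      exact SlashInvariantForm.slash_action_generators_SL2Z hS hT A
    holo' := mdifferentiable_heckeDiscriminant q
    zero_at_cusps' := by
      intro c hc
      rw [Subgroup.IsArithmetic.isCusp_iff_isCusp_SL2Z] at hc
      rw [OnePoint.isZeroAt_iff_forall_SL2Z hc]
      intro γ _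
      rw [SlashInvariantForm.slash_action_generators_SL2Z hS hT]
      exact heckeDiscriminant_isZeroAtImInfty q }

theorem exists_heckeDiscriminant_eq : ∃ c : ℂ, ∀ z, heckeDiscriminant q z = c * Δ z := by
  obtain ⟨c, hc⟩ := CuspForm.exists_smul_discriminant_of_weight_eq_twelve
    (heckeDiscriminantCuspForm q)
  exact ⟨c, fun z => (DFunLike.congr_fun hc z).symm⟩

theorem sum_exp_heckeDown (m : ℕ) :
    ∑ b : ZMod q, cexp (2 * π * I * ((b.val : ℤ) : ℂ) / q) ^ m = if q ∣ m then (q : ℂ) else 0 := by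
  have h := AddChar.sum_mulShift (R := ZMod q) (m : ZMod q) (ZMod.isPrimitive_stdAddChar q)
  rw [ZMod.card] at h
  simp only [ZMod.natCast_eq_zero_iff] at h
  rw [apply_ite (Nat.cast : ℕ → ℂ), Nat.cast_zero] at h
  rw [← h]
  refine Finset.sum_congr rfl fun b _ => ?_
  have h1 : (b * m : ZMod q) = (((b.val : ℤ) * m : ℤ) : ZMod q) := by simp
  rw [h1, ZMod.stdAddChar_coe, ← Complex.exp_nat_mul]
  congr 1
  push_cast
  ring

/-- Orthogonality of the additive characters mod `q` keeps only the exponents divisible by `q`. -/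
theorem hasSum_sum_heckeDown (hq : 0 < q) (z : ℍ) :
    HasSum (fun n : ℕ => (ramanujanTau (q * n) : ℂ) * cexp (2 * π * I * z) ^ n)
      ((q : ℂ)⁻¹ * ∑ b : ZMod q, Δ (heckeDown q hq b.val z)) := by
  have hq' : (q : ℂ) ≠ 0 := by exact_mod_cast hq.ne'
  have hinj : Function.Injective fun m : ℕ => q * m := fun a b h => Nat.eq_of_mul_eq_mul_left hq h
  have h := (hasSum_sum fun (b : ZMod q) (_ : b ∈ Finset.univ) =>
    hasSum_discriminant (heckeDown q hq b.val z)).mul_left (q : ℂ)⁻¹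
  have e : ∀ m : ℕ, (q : ℂ)⁻¹ * ∑ b : ZMod q,
      (ramanujanTau m : ℂ) * cexp (2 * π * I * (heckeDown q hq b.val z)) ^ m =
      (if q ∣ m then (ramanujanTau m : ℂ) * cexp (2 * π * I * z / q) ^ m else 0) := by
    intro m
    have e1 : ∀ b : ZMod q, (ramanujanTau m : ℂ) * cexp (2 * π * I * (heckeDown q hq b.val z)) ^ m
        = ((ramanujanTau m : ℂ) * cexp (2 * π * I * z / q) ^ m) *
          cexp (2 * π * I * ((b.val : ℤ) : ℂ) / q) ^ m := by
      intro b
      rw [mul_assoc (ramanujanTau m : ℂ), ← mul_pow, ← Complex.exp_add, coe_heckeDown]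
      ring_nf
    simp only [e1]
    rw [← Finset.mul_sum, sum_exp_heckeDown]
    split_ifs
    · field_simp
    · simp
  simp only [e] at h
  rw [← hinj.hasSum_iff] at h
  · refine (congrArg (fun f => HasSum f _) (funext fun n => ?_)).mp h
    rw [Function.comp_apply, if_pos (dvd_mul_right q n), pow_mul, ← Complex.exp_nat_mul]
    congr 3
    field_simp
  · intro m hm
    rw [if_neg]
    rintro ⟨n, rfl⟩
    exact hm ⟨n, rfl⟩

theorem ramanujanTau_eq_of_hasSum {c : ℕ → ℂ} {a : ℂ}
    (h : ∀ z : ℍ, HasSum (fun n => c n * cexp (2 * π * I * z) ^ n) (a * Δ z)) (n : ℕ) :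
    c n = a * ramanujanTau n := by
  have hf : ∀ z : ℍ, HasSum (fun m => c m • Function.Periodic.qParam 1 z ^ m)
      ((a • CuspForm.discriminant : CuspForm 𝒮ℒ 12) z) := by
    intro z
    simpa [Function.Periodic.qParam] using h z
  have hf' : ∀ z : ℍ, HasSum (fun m => (a * ramanujanTau m) • Function.Periodic.qParam 1 z ^ m)
      ((a • CuspForm.discriminant : CuspForm 𝒮ℒ 12) z) := by
    intro z
    simpa [Function.Periodic.qParam, mul_assoc] using (hasSum_discriminant z).mul_left a
  rw [ModularFormClass.qExpansion_coeff_unique one_pos one_mem_strictPeriods_SL hf n,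
    ← ModularFormClass.qExpansion_coeff_unique one_pos one_mem_strictPeriods_SL hf' n]

theorem ramanujanTau_one : ramanujanTau 1 = 1 := by
  have h := coeff_qExpansion_discriminant 1
  rw [discriminant_qExpansion_coeff_one] at h
  exact_mod_cast h.symm

/-- Mordell's relation for the Ramanujan function. -/
theorem ramanujanTau_hecke (n : ℕ) :
    ramanujanTau q * ramanujanTau n =
      ramanujanTau (q * n) + (q : ℤ) ^ 11 * if q ∣ n then ramanujanTau (n / q) else 0 := by
  have hq := (Fact.out : q.Prime).pos
  obtain ⟨a, ha⟩ := exists_heckeDiscriminant_eq q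
  have h : ∀ z : ℍ, HasSum (fun n : ℕ => ((ramanujanTau (q * n) : ℂ) +
      (q : ℂ) ^ 11 * (if q ∣ n then (ramanujanTau (n / q) : ℂ) else 0)) *
      cexp (2 * π * I * z) ^ n) (a * Δ z) := by
    intro z
    rw [← ha, heckeDiscriminant, add_comm]
    convert (hasSum_sum_heckeDown q hq z).add ((hasSum_heckeUp q hq z).mul_left ((q : ℂ) ^ 11))
      using 2 with n
    ring
  -- The coefficient at `1` identifies the eigenvalue `a` as `τ(q)`.
  have h1 := ramanujanTau_eq_of_hasSum h 1
  have hn := ramanujanTau_eq_of_hasSum h n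
  rw [if_neg (by simpa using (Fact.out : q.Prime).one_lt.ne'), mul_one, mul_zero, add_zero,
    ramanujanTau_one, Int.cast_one, mul_one] at h1
  rw [← h1] at hn
  have : ((ramanujanTau q * ramanujanTau n : ℤ) : ℂ) =
      ((ramanujanTau (q * n) + (q : ℤ) ^ 11 * if q ∣ n then ramanujanTau (n / q) else 0 : ℤ) : ℂ) := by
    push_cast
    exact hn.symm
  exact_mod_cast this

end ModularForm

end HeckeOperator

/-! ### Multiplicativity of `τ` -/

theorem ramanujanTau_prime_mul {q n : ℕ} (hq : q.Prime) (h : ¬ q ∣ n) :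
    ramanujanTau (q * n) = ramanujanTau q * ramanujanTau n := by
  have := Fact.mk hq
  rw [ModularForm.ramanujanTau_hecke, if_neg h, mul_zero, add_zero]

theorem ramanujanTau_prime_sq {q : ℕ} (hq : q.Prime) :
    ramanujanTau q ^ 2 - ramanujanTau (q ^ 2) = (q : ℤ) ^ 11 := by
  have := Fact.mk hq
  have := ModularForm.ramanujanTau_hecke q q
  rw [if_pos dvd_rfl, Nat.div_self hq.pos, ModularForm.ramanujanTau_one] at this
  rw [sq q, sq (ramanujanTau q), this]
  ring

/-- As functions of `a`, both sides obey the same two-term recurrence, Mordell's relation. -/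
theorem ramanujanTau_pow_mul {q m : ℕ} (hq : q.Prime) (h : ¬ q ∣ m) (a : ℕ) :
    ramanujanTau (q ^ a * m) = ramanujanTau (q ^ a) * ramanujanTau m := by
  have := Fact.mk hq
  induction a using Nat.twoStepInduction with
  | zero => simp [ModularForm.ramanujanTau_one]
  | one => simpa using ramanujanTau_prime_mul hq h
  | more a ih0 ih1 =>
    have h1 := ModularForm.ramanujanTau_hecke q (q ^ (a + 1) * m)
    have h2 := ModularForm.ramanujanTau_hecke q (q ^ (a + 1))
    have hd : q ∣ q ^ (a + 1) := dvd_pow_self q (by simp)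
    have e1 : q ^ (a + 1) * m / q = q ^ a * m := by
      rw [pow_succ', mul_assoc, Nat.mul_div_cancel_left _ hq.pos]
    have e2 : q ^ (a + 1) / q = q ^ a := by
      rw [pow_succ', Nat.mul_div_cancel_left _ hq.pos]
    rw [if_pos (hd.mul_right m), ← mul_assoc q, ← pow_succ', e1, ih0, ih1] at h1
    rw [if_pos hd, ← pow_succ', e2] at h2
    linear_combination h2 * ramanujanTau m - h1

theorem ramanujanTau_mul_of_coprime {n m : ℕ} (h : n.Coprime m) :
    ramanujanTau (n * m) = ramanujanTau n * ramanujanTau m := by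
  have h0 : ramanujanTau 0 = 0 := by
    simp [ramanujanTau, ramanujanTauSeries]
  induction n using Nat.recOnPosPrimePosCoprime generalizing m with
  | zero => simp [h0]
  | one => simp [ModularForm.ramanujanTau_one]
  | prime_pow p k hp hk =>
    exact ramanujanTau_pow_mul hp
      ((Nat.Prime.coprime_iff_not_dvd hp).1 (Nat.Coprime.coprime_dvd_left (dvd_pow_self p hk.ne') h)) k
  | coprime a b ha hb hab iha ihb =>
    have h' := Nat.coprime_mul_iff_left.1 h
    rw [mul_assoc, iha (Nat.Coprime.mul_right hab h'.1), ihb h'.2, iha hab]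
    ring

/-! ### Sums of dilates in `ℤ/p` -/

theorem card_sq_le_card_image_mul_collisions {α β : Type*} [DecidableEq β]
    (s : Finset α) (f : α → β) :
    s.card ^ 2 ≤ (s.image f).card * ((s ×ˢ s).filter fun x => f x.1 = f x.2).card := by
  have h1 : s.card = ∑ y ∈ s.image f, (s.filter fun a => f a = y).card :=
    Finset.card_eq_sum_card_image f s
  have h2 : ((s ×ˢ s).filter fun x => f x.1 = f x.2).card =
      ∑ y ∈ s.image f, (s.filter fun a => f a = y).card ^ 2 := by
    rw [Finset.card_eq_sum_card_fiberwise (f := fun x => f x.1) (t := s.image f)]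
    · refine Finset.sum_congr rfl fun y _ => ?_
      rw [sq, ← Finset.card_product]
      congr 1
      ext ⟨a, b⟩
      simp only [Finset.mem_filter, Finset.mem_product]
      grind
    · intro x hx
      simp only [Finset.coe_filter, Set.mem_ofPred_eq, Finset.mem_product] at hx
      exact Finset.mem_coe.2 (Finset.mem_image_of_mem f hx.1.1)
  rw [h2, h1]
  exact sq_sum_le_card_mul_sum_sq

/-- Equal pairs collide for all `p - 1` dilations, while two distinct pairs collide for at most one.
-/
theorem sum_card_dilate_collisions_le {p : ℕ} [Fact p.Prime] (A B : Finset (ZMod p)) :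
    ∑ ξ ∈ Finset.univ.erase (0 : ZMod p),
      (((A ×ˢ B) ×ˢ (A ×ˢ B)).filter fun x => x.1.1 + ξ * x.1.2 = x.2.1 + ξ * x.2.2).card ≤
      (A.card * B.card) * (p - 1) + (A.card * B.card) ^ 2 := by
  simp only [Finset.card_filter]
  rw [Finset.sum_comm]
  have hb : ∀ x ∈ (A ×ˢ B) ×ˢ (A ×ˢ B), (∑ ξ ∈ Finset.univ.erase (0 : ZMod p),
      if x.1.1 + ξ * x.1.2 = x.2.1 + ξ * x.2.2 then 1 else 0) ≤
      (if x.1 = x.2 then p - 1 else 0) + 1 := by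
    rintro ⟨⟨a, b⟩, ⟨a', b'⟩⟩ _
    rw [← Finset.card_filter]
    by_cases h : ((a, b) : ZMod p × ZMod p) = (a', b')
    · rw [if_pos h]
      refine (Finset.card_filter_le _ _).trans ?_
      rw [Finset.card_erase_of_mem (Finset.mem_univ _), Finset.card_univ, ZMod.card]
      exact Nat.le_succ _
    · rw [if_neg h, zero_add, Finset.card_le_one]
      intro ξ hξ η hη
      simp only [Finset.mem_filter, Finset.mem_erase] at hξ hη
      have e : (ξ - η) * (b - b') = 0 := by linear_combination hξ.2 - hη.2
      rcases mul_eq_zero.1 e with e | e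
      · exact sub_eq_zero.1 e
      · exfalso
        have hbb := sub_eq_zero.1 e
        subst hbb
        exact h (by rw [add_right_cancel hξ.2])
  refine (Finset.sum_le_sum hb).trans ?_
  rw [Finset.sum_add_distrib, Finset.sum_const, smul_eq_mul, mul_one, Finset.card_product,
    Finset.card_product, ← sq, ← Finset.sum_filter, Finset.sum_const, smul_eq_mul]
  gcongr
  rw [← Finset.card_product, ← Finset.diag_card (A ×ˢ B)]
  apply Finset.card_le_card
  intro x
  simp only [Finset.mem_filter, Finset.mem_product, Finset.mem_diag]
  tauto

/-- Some dilate sum of two large sets fills more than half of `ℤ/p`. -/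
theorem exists_card_lt_two_mul_image_add_dilate {p : ℕ} [Fact p.Prime] (A B : Finset (ZMod p))
    (h : 3 * p ≤ A.card * B.card) :
    ∃ ξ : ZMod p, ξ ≠ 0 ∧ p < 2 * ((A ×ˢ B).image fun x => x.1 + ξ * x.2).card := by
  have hp2 := (Fact.out : p.Prime).two_le
  have hp3 : 3 ≤ p := by
    have h1 := Nat.mul_le_mul (Finset.card_le_univ A) (Finset.card_le_univ B)
    rw [ZMod.card] at h1
    exact Nat.le_of_mul_le_mul_right (h.trans h1) (by omega)
  set N := A.card * B.card with hN
  have hcard : (Finset.univ.erase (0 : ZMod p)).card = p - 1 := by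
    rw [Finset.card_erase_of_mem (Finset.mem_univ _), Finset.card_univ, ZMod.card]
  by_contra! hcon
  have h1 : ∀ ξ ∈ Finset.univ.erase (0 : ZMod p), 2 * N ^ 2 ≤ p *
      (((A ×ˢ B) ×ˢ (A ×ˢ B)).filter fun x => x.1.1 + ξ * x.1.2 = x.2.1 + ξ * x.2.2).card := by
    intro ξ hξ
    have h2 := card_sq_le_card_image_mul_collisions (A ×ˢ B) fun x => x.1 + ξ * x.2
    rw [Finset.card_product] at h2
    calc 2 * N ^ 2 ≤ 2 * _ := Nat.mul_le_mul_left 2 h2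
      _ ≤ _ := by
        rw [← mul_assoc]
        exact Nat.mul_le_mul_right _ (hcon ξ (Finset.ne_of_mem_erase hξ))
  have h2 := Finset.sum_le_sum h1
  rw [Finset.sum_const, hcard, smul_eq_mul, ← Finset.mul_sum] at h2
  have h3 := h2.trans (Nat.mul_le_mul_left p (sum_card_dilate_collisions_le A B))
  rw [← hN] at h3
  have hNpos : 0 < N := by omega
  obtain ⟨k, rfl⟩ : ∃ k, p = k + 1 := ⟨p - 1, by omega⟩
  have h4 : N * ((k) * (2 * N)) ≤ N * ((k + 1) * (k + N)) := by
    rw [Nat.add_sub_cancel] at h3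
    calc _ = k * (2 * N ^ 2) := by ring
      _ ≤ _ := h3
      _ = _ := by ring
  have h5 := Nat.le_of_mul_le_mul_left h4 hNpos
  -- With `p = k + 1`, `h5` reads `N (k - 1) ≤ k (k + 1)`, which contradicts `N ≥ 3 (k + 1)` as `k ≥
  -- 2`.
  nlinarith

/-- Some dilate sum of two large sets fills more than half of `ℤ/p`, with the dilation factor a
quotient of differences. -/
theorem exists_card_lt_two_mul_image_add {p : ℕ} [Fact p.Prime] (A B : Finset (ZMod p))
    (h : 3 * p ≤ A.card * B.card) :
    ∃ a₁ ∈ A, ∃ a₂ ∈ A, ∃ b₁ ∈ B, ∃ b₂ ∈ B,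
      p < 2 * ((A ×ˢ B).image fun x => (b₂ - b₁) * x.1 + (a₁ - a₂) * x.2).card := by
  have hp := (Fact.out : p.Prime).pos
  obtain ⟨ξ, hξ, hc⟩ := exists_card_lt_two_mul_image_add_dilate A B h
  -- More than `p` pairs must collide, so `ξ = (a₁ - a₂) / (b₂ - b₁)`; multiplying by `b₂ - b₁`
  -- clears the denominator.
  obtain ⟨⟨a₁, b₁⟩, h1, ⟨a₂, b₂⟩, h2, hne, heq⟩ :=
    Finset.exists_ne_map_eq_of_card_lt_of_maps_to (s := A ×ˢ B) (t := Finset.univ)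
      (f := fun x : ZMod p × ZMod p => x.1 + ξ * x.2)
      (by rw [Finset.card_univ, ZMod.card, Finset.card_product]; omega) (fun _ _ => Finset.mem_univ _)
  rw [Finset.mem_product] at h1 h2
  refine ⟨a₁, h1.1, a₂, h2.1, b₁, h1.2, b₂, h2.2, hc.trans_eq ?_⟩
  have hb : b₂ - b₁ ≠ 0 := by
    intro hb
    have hbb := sub_eq_zero.1 hb
    subst hbb
    exact hne (Prod.ext (add_right_cancel heq) rfl)
  have e : (fun x : ZMod p × ZMod p => (b₂ - b₁) * x.1 + (a₁ - a₂) * x.2) =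
      (fun t => (b₂ - b₁) * t) ∘ fun x => x.1 + ξ * x.2 := by
    ext x
    simp only [Function.comp]
    linear_combination x.2 * heq
  rw [e, ← Finset.image_image, Finset.card_image_of_injective _ (mul_right_injective₀ hb)]

/-- A set `S` filling more than half of `ℤ/p` meets `l - S`, so `l` is a sum of two elements of `S`.
Each of these is a sum of four products, since `A = -A`. -/
theorem exists_sum_eight_mul {p : ℕ} [Fact p.Prime] (A B : Finset (ZMod p))
    (h : 3 * p ≤ A.card * B.card) (hA : ∀ a ∈ A, -a ∈ A) (l : ZMod p) :
    ∃ x y : Fin 8 → ZMod p, (∀ i, x i ∈ A) ∧ (∀ i, y i ∈ B) ∧ ∑ i, x i * y i = l := by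
  obtain ⟨a₁, ha₁, a₂, ha₂, b₁, hb₁, b₂, hb₂, hc⟩ := exists_card_lt_two_mul_image_add A B h
  generalize hS : (A ×ˢ B).image (fun x => (b₂ - b₁) * x.1 + (a₁ - a₂) * x.2) = S at hc
  have hne : (S ∩ S.image fun s => l - s).Nonempty := by
    rw [Finset.nonempty_iff_ne_empty]
    intro he
    have h1 := Finset.card_union_add_card_inter S (S.image fun s => l - s)
    rw [he, Finset.card_empty, Finset.card_image_of_injective _ (sub_right_injective)] at h1
    have h2 := Finset.card_le_univ (S ∪ S.image fun s => l - s)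
    rw [ZMod.card] at h2
    omega
  obtain ⟨s, hs⟩ := hne
  rw [Finset.mem_inter, Finset.mem_image] at hs
  obtain ⟨hs1, t, ht, hst⟩ := hs
  rw [← hS, Finset.mem_image] at hs1 ht
  obtain ⟨⟨a, b⟩, hab, rfl⟩ := hs1
  obtain ⟨⟨a', b'⟩, hab', rfl⟩ := ht
  rw [Finset.mem_product] at hab hab'
  refine ⟨![a, -a, a₁, -a₂, a', -a', a₁, -a₂], ![b₂, b₁, b, b, b₂, b₁, b', b'], ?_, ?_, ?_⟩
  · intro i
    fin_cases i <;> simp [hab, hab', ha₁, ha₂, hA]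
  · intro i
    fin_cases i <;> simp [hab, hab', hb₁, hb₂]
  · simp [Fin.sum_univ_succ]
    linear_combination -hst

/-! ### Differences of values of `τ` -/

/-- The positive integers up to `N` all of whose prime factors lie in `Q`. -/
def factoredUpTo (Q : Finset ℕ) (N : ℕ) : Finset ℕ :=
  (Finset.Icc 1 N).filter fun n => n.primeFactors ⊆ Q

theorem mem_factoredUpTo {Q : Finset ℕ} {N n : ℕ} :
    n ∈ factoredUpTo Q N ↔ (0 < n ∧ n ≤ N) ∧ n.primeFactors ⊆ Q := by
  simp [factoredUpTo, Nat.lt_iff_add_one_le]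

/-- The differences modulo `p` of values of `τ` on integers composed of primes in `Q`. -/
noncomputable def tauDifferences (p : ℕ) (Q : Finset ℕ) (N : ℕ) : Finset (ZMod p) :=
  (factoredUpTo Q N ×ˢ factoredUpTo Q N).image fun x =>
    (ramanujanTau x.1 : ZMod p) - ramanujanTau x.2

theorem mem_tauDifferences {p : ℕ} {Q : Finset ℕ} {N : ℕ} {a : ZMod p} :
    a ∈ tauDifferences p Q N ↔ ∃ n ∈ factoredUpTo Q N, ∃ m ∈ factoredUpTo Q N,
      (ramanujanTau n : ZMod p) - ramanujanTau m = a := by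
  simp only [tauDifferences, Finset.mem_image, Finset.mem_product, Prod.exists]
  grind

theorem neg_mem_tauDifferences {p : ℕ} {Q : Finset ℕ} {N : ℕ} {a : ZMod p}
    (h : a ∈ tauDifferences p Q N) : -a ∈ tauDifferences p Q N := by
  obtain ⟨n, hn, m, hm, rfl⟩ := mem_tauDifferences.1 h
  exact mem_tauDifferences.2 ⟨m, hm, n, hn, by ring⟩

theorem card_le_mul_card_image_pow {R : Type*} [CommRing R] [IsDomain R] [DecidableEq R]
    (s : Finset R) {k : ℕ} (hk : 0 < k) : s.card ≤ k * (s.image (· ^ k)).card := by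
  refine Finset.card_le_mul_card_image s k fun b _ => ?_
  refine le_trans ?_ (Polynomial.card_nthRoots k b)
  refine le_trans (Finset.card_le_card (t := (Polynomial.nthRoots k b).toFinset) ?_)
    (Multiset.toFinset_card_le _)
  intro x hx
  rw [Multiset.mem_toFinset, Polynomial.mem_nthRoots hk]
  exact (Finset.mem_filter.1 hx).2

/-- Split `Q` into the primes `U` whose value of `τ` mod `p` is unshared and the rest `V`. Then `U`
contributes at most `|A|` and `V` at most `11 |A|`, so `22` leaves room. -/
theorem card_le_mul_card_tauDifferences {p : ℕ} [Fact p.Prime] {Q : Finset ℕ} {L : ℕ}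
    (hQ : ∀ q ∈ Q, q.Prime) (hL : ∀ q ∈ Q, q ≤ L) (hp : ∀ q ∈ Q, q < p) :
    Q.card ≤ 22 * (tauDifferences p Q (L ^ 2)).card := by
  classical
  have hmul : ∀ q ∈ Q, ∀ r ∈ Q, q * r ∈ factoredUpTo Q (L ^ 2) := by
    intro q hq r hr
    refine mem_factoredUpTo.2 ⟨⟨Nat.mul_pos (hQ q hq).pos (hQ r hr).pos, ?_⟩, ?_⟩
    · rw [sq]; exact Nat.mul_le_mul (hL q hq) (hL r hr)
    · rw [Nat.primeFactors_mul (hQ q hq).ne_zero (hQ r hr).ne_zero, (hQ q hq).primeFactors,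
        (hQ r hr).primeFactors]
      intro x; simp only [Finset.mem_union, Finset.mem_singleton]; rintro (rfl | rfl) <;> assumption
  have hone : ∀ q ∈ Q, q ∈ factoredUpTo Q (L ^ 2) := by
    intro q hq
    refine mem_factoredUpTo.2 ⟨⟨(hQ q hq).pos, (hL q hq).trans (Nat.le_self_pow two_ne_zero L)⟩, ?_⟩
    rw [(hQ q hq).primeFactors]; simpa using hq
  set f : ℕ → ZMod p := fun q => ramanujanTau q with hf
  set U := Q.filter fun q => ∀ r ∈ Q, f r = f q → r = q with hU
  set V := Q.filter fun q => ¬ ∀ r ∈ Q, f r = f q → r = q with hV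
  have hUV : U.card + V.card = Q.card := Finset.card_filter_add_card_filter_not _
  have hUc : U.card ≤ (tauDifferences p Q (L ^ 2)).card := by
    rcases Q.eq_empty_or_nonempty with h | ⟨q₀, hq₀⟩
    · simp [hU, h]
    refine Finset.card_le_card_of_injOn (fun q => f q - f q₀) ?_ ?_
    · intro q hq
      exact mem_tauDifferences.2 ⟨q, hone q (Finset.mem_filter.1 hq).1, q₀, hone q₀ hq₀, rfl⟩
    · intro q hq r hr h
      exact (Finset.mem_filter.1 hr).2 q (Finset.mem_filter.1 hq).1 (sub_left_injective h)
  have hVc : V.card ≤ 11 * (tauDifferences p Q (L ^ 2)).card := by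
    -- Primes below `p` are distinct mod `p`, and `x ↦ x¹¹` is at most 11-to-1.
    have hinj : Set.InjOn (Nat.cast : ℕ → ZMod p) V := by
      intro q hq r hr h
      have h1 := hp q (Finset.mem_filter.1 hq).1
      have h2 := hp r (Finset.mem_filter.1 hr).1
      have h3 := congrArg ZMod.val h
      rwa [ZMod.val_cast_of_lt h1, ZMod.val_cast_of_lt h2] at h3
    rw [← Finset.card_image_of_injOn hinj]
    refine (card_le_mul_card_image_pow _ (k := 11) (by norm_num)).trans ?_
    refine Nat.mul_le_mul_left 11 (Finset.card_le_card ?_)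
    rw [Finset.image_image]
    intro x hx
    obtain ⟨q, hq, rfl⟩ := Finset.mem_image.1 hx
    obtain ⟨hqQ, hq2⟩ := Finset.mem_filter.1 hq
    push Not at hq2
    obtain ⟨r, hrQ, hfr, hne⟩ := hq2
    -- If `τ(r) ≡ τ(q)` with `r ≠ q`, then `τ(qr) - τ(q²) ≡ τ(q)² - τ(q²) = q¹¹`.
    refine mem_tauDifferences.2 ⟨q * r, hmul q hqQ r hrQ, q * q, hmul q hqQ q hqQ, ?_⟩
    have h1 := ramanujanTau_prime_sq (hQ q hqQ)
    have h2 := ramanujanTau_mul_of_coprime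
      ((Nat.coprime_primes (hQ q hqQ) (hQ r hrQ)).2 hne.symm)
    have h1' := congrArg (Int.cast : ℤ → ZMod p) h1
    push_cast at h1'
    simp only [hf] at hfr
    rw [h2, Int.cast_mul, hfr, Function.comp_apply, ← h1', sq, sq]
  omega

theorem coprime_of_mem_factoredUpTo {Q R : Finset ℕ} {N M n m : ℕ} (h : Disjoint Q R)
    (hn : n ∈ factoredUpTo Q N) (hm : m ∈ factoredUpTo R M) : n.Coprime m := by
  rw [mem_factoredUpTo] at hn hm
  rw [← Nat.disjoint_primeFactors hn.1.1.ne' hm.1.1.ne']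
  exact Finset.disjoint_of_subset_left hn.2 (Finset.disjoint_of_subset_right hm.2 h)

theorem coprime_factorial_of_mem_factoredUpTo {Q : Finset ℕ} {N n k : ℕ} (h : ∀ q ∈ Q, k < q)
    (hn : n ∈ factoredUpTo Q N) : n.Coprime k.factorial := by
  rw [mem_factoredUpTo] at hn
  refine Nat.coprime_of_dvd fun r hr hrn hrk => ?_
  have h1 := h r (hn.2 (Nat.mem_primeFactors.2 ⟨hr, hrn, hn.1.1.ne'⟩))
  have h2 := (Nat.Prime.dvd_factorial hr).1 hrk
  omega

/-- Two large disjoint sets of primes below `L` give the congruence with variables at most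
`L ^ 4`. -/
theorem exists_tau_congruence {p : ℕ} (hp : p.Prime) {Q R : Finset ℕ} {L : ℕ}
    (hQR : Disjoint Q R) (hprime : ∀ q ∈ Q ∪ R, q.Prime) (hL : ∀ q ∈ Q ∪ R, q ≤ L) (hLp : L < p)
    (h23 : ∀ q ∈ Q ∪ R, 23 < q) (hcard : 3 * 22 ^ 2 * p ≤ Q.card * R.card) (l : ℤ) :
    ∃ n m : Fin 16 → ℕ,
      (∑ i, ramanujanTau (n i)) - (∑ i, ramanujanTau (m i)) ≡ l [ZMOD (p : ℤ)] ∧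
      (∀ i, (0 < n i ∧ n i ≤ L ^ 4 ∧ (n i).Coprime (Nat.factorial 23)) ∧
        (0 < m i ∧ m i ≤ L ^ 4 ∧ (m i).Coprime (Nat.factorial 23))) := by
  have := Fact.mk hp
  have hQ := card_le_mul_card_tauDifferences (p := p) (Q := Q) (L := L)
    (fun q hq => hprime q (Finset.mem_union_left _ hq))
    (fun q hq => hL q (Finset.mem_union_left _ hq))
    (fun q hq => (hL q (Finset.mem_union_left _ hq)).trans_lt hLp)
  have hR := card_le_mul_card_tauDifferences (p := p) (Q := R) (L := L)
    (fun q hq => hprime q (Finset.mem_union_right _ hq))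
    (fun q hq => hL q (Finset.mem_union_right _ hq))
    (fun q hq => (hL q (Finset.mem_union_right _ hq)).trans_lt hLp)
  have hAB : 3 * p ≤ (tauDifferences p Q (L ^ 2)).card * (tauDifferences p R (L ^ 2)).card := by
    have := hcard.trans (Nat.mul_le_mul hQ hR)
    nlinarith
  obtain ⟨x, y, hx, hy, hxy⟩ := exists_sum_eight_mul _ _ hAB
    (fun _ => neg_mem_tauDifferences) (l : ZMod p)
  simp only [mem_tauDifferences] at hx hy
  choose a ha a' ha' haa using hx
  choose b hb b' hb' hbb using hy
  have key : ∀ u ∈ factoredUpTo Q (L ^ 2), ∀ v ∈ factoredUpTo R (L ^ 2),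
      ramanujanTau (u * v) = ramanujanTau u * ramanujanTau v ∧
      (0 < u * v ∧ u * v ≤ L ^ 4 ∧ (u * v).Coprime (Nat.factorial 23)) := by
    intro u hu v hv
    refine ⟨ramanujanTau_mul_of_coprime (coprime_of_mem_factoredUpTo hQR hu hv), ?_, ?_, ?_⟩
    · exact Nat.mul_pos (mem_factoredUpTo.1 hu).1.1 (mem_factoredUpTo.1 hv).1.1
    · exact (Nat.mul_le_mul (mem_factoredUpTo.1 hu).1.2 (mem_factoredUpTo.1 hv).1.2).trans_eq
        (by ring)
    · exact Nat.Coprime.mul_left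
        (coprime_factorial_of_mem_factoredUpTo (fun q hq => h23 q (Finset.mem_union_left _ hq)) hu)
        (coprime_factorial_of_mem_factoredUpTo (fun q hq => h23 q (Finset.mem_union_right _ hq)) hv)
  -- Each of the eight products of differences expands into two positive and two negative terms.
  refine ⟨Fin.append (fun i : Fin 8 => a i * b i) (fun i : Fin 8 => a' i * b' i),
    Fin.append (fun i : Fin 8 => a i * b' i) (fun i : Fin 8 => a' i * b i), ?_, ?_⟩
  · rw [← ZMod.intCast_eq_intCast_iff]
    rw [Fin.sum_univ_add (a := 8) (b := 8), Fin.sum_univ_add (a := 8) (b := 8)]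
    simp only [Fin.append_left, Fin.append_right]
    push_cast
    rw [← hxy, ← Finset.sum_add_distrib, ← Finset.sum_add_distrib, ← Finset.sum_sub_distrib]
    refine Finset.sum_congr rfl fun i _ => ?_
    rw [(key _ (ha i) _ (hb i)).1, (key _ (ha' i) _ (hb' i)).1, (key _ (ha i) _ (hb' i)).1,
      (key _ (ha' i) _ (hb i)).1, ← haa, ← hbb]
    push_cast
    ring
  · intro i
    refine Fin.addCases (m := 8) (n := 8) (fun j => ?_) (fun j => ?_) i
    · simp only [Fin.append_left]
      exact ⟨(key _ (ha j) _ (hb j)).2, (key _ (ha j) _ (hb' j)).2⟩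
    · simp only [Fin.append_right]
      exact ⟨(key _ (ha' j) _ (hb' j)).2, (key _ (ha' j) _ (hb j)).2⟩

/-! ### Counting primes and the conclusion -/

/-- There are enough primes below `200 √p log p`. -/
theorem eventually_le_primeCounting :
    ∀ᶠ p : ℕ in Filter.atTop, ⌊200 * (√(p : ℝ) * Real.log p)⌋₊ < p ∧
      80 * √(p : ℝ) + 12 ≤ Nat.primeCounting ⌊200 * (√(p : ℝ) * Real.log p)⌋₊ := by
  -- The factor `1 / 400` yields `200 √p log p ≤ p / 2`, hence `L < p`.
  have h1 : ∀ᶠ x : ℝ in Filter.atTop, Real.log x ≤ (1 / 400) * x ^ (1 / 2 : ℝ) := by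
    filter_upwards [(isLittleO_log_rpow_atTop (r := 1 / 2) (by norm_num)).bound
      (by norm_num : (0 : ℝ) < 1 / 400), Filter.eventually_ge_atTop 1] with x hx hx1
    rwa [Real.norm_of_nonneg (Real.log_nonneg hx1), Real.norm_of_nonneg (by positivity)] at hx
  filter_upwards [tendsto_natCast_atTop_atTop.eventually h1,
    Filter.eventually_ge_atTop 10000] with p hlog hp
  rw [← Real.sqrt_eq_rpow] at hlog
  have hp' : (10000 : ℝ) ≤ p := by exact_mod_cast hp
  have hs : (100 : ℝ) ≤ √(p : ℝ) := by
    apply Real.le_sqrt_of_sq_le; linarith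
  have hss : √(p : ℝ) * √(p : ℝ) = p := Real.mul_self_sqrt (by positivity)
  have hl1 : 1 ≤ Real.log p := by
    rw [Real.le_log_iff_exp_le (by positivity)]
    linarith [Real.exp_one_lt_d9]
  set L := ⌊200 * (√(p : ℝ) * Real.log p)⌋₊ with hL
  have hX : 200 * (√(p : ℝ) * Real.log p) ≤ p / 2 := by nlinarith
  have hLX : (L : ℝ) ≤ 200 * (√(p : ℝ) * Real.log p) := Nat.floor_le (by positivity)
  have hXL : 200 * (√(p : ℝ) * Real.log p) - 1 < L := by
    have := Nat.lt_floor_add_one (200 * (√(p : ℝ) * Real.log p)); linarith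
  have hLp : (L : ℝ) + 1 ≤ p := by linarith
  have hL2 : (2 : ℝ) ≤ L := by nlinarith
  refine ⟨by exact_mod_cast (by linarith : (L : ℝ) < p), ?_⟩
  refine le_trans ?_ (Chebyshev.pi_ge L)
  have hlogL : 0 < Real.log L := Real.log_pos (by linarith)
  have hlogLp : Real.log L ≤ Real.log p := Real.log_le_log (by linarith) (by linarith)
  have hlogLp1 : Real.log (L + 1) ≤ Real.log p := Real.log_le_log (by linarith) hLp
  rw [le_div_iff₀ hlogL]
  have h2 := Real.log_two_gt_d9
  have h3 : (80 * √(p : ℝ) + 12) * Real.log L ≤ (80 * √(p : ℝ) + 12) * Real.log p := by gcongr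
  have h4 : (200 * (√(p : ℝ) * Real.log p) - 1) * 0.69 ≤ L * Real.log 2 := by
    apply mul_le_mul hXL.le (by linarith) (by norm_num) (by positivity)
  -- The main terms are `200 · 0.69 = 138` against `80`, both times `√p log p`.
  nlinarith

theorem theorem2 :
    ∃ C : ℝ, 0 < C ∧ ∃ p₀ : ℕ, ∀ p : ℕ, p.Prime → p₀ ≤ p → ∀ l : ℤ,
      ∃ n m : Fin 16 → ℕ,
        (∑ i, ramanujanTau (n i)) - (∑ i, ramanujanTau (m i)) ≡ l [ZMOD (p : ℤ)] ∧
        (∀ i, 0 < n i ∧ 0 < m i) ∧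
        (∀ i, (n i : ℝ) ≤ C * ((p : ℝ) ^ 2 * Real.log (p : ℝ) ^ 4) ∧
          (m i : ℝ) ≤ C * ((p : ℝ) ^ 2 * Real.log (p : ℝ) ^ 4)) ∧
        (∀ i, Nat.gcd (n i * m i) (Nat.factorial 23) = 1) := by
  obtain ⟨p₀, hp₀⟩ := Filter.eventually_atTop.1 eventually_le_primeCounting
  refine ⟨200 ^ 4, by norm_num, p₀, fun p hp hpp l => ?_⟩
  obtain ⟨hLp, hpi⟩ := hp₀ p hpp
  set L := ⌊200 * (√(p : ℝ) * Real.log p)⌋₊ with hL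
  have hlog : 0 ≤ Real.log p := Real.log_natCast_nonneg p
  have hL4 : ((L ^ 4 : ℕ) : ℝ) ≤ 200 ^ 4 * ((p : ℝ) ^ 2 * Real.log (p : ℝ) ^ 4) := by
    have h1 : (L : ℝ) ≤ 200 * (√(p : ℝ) * Real.log p) := Nat.floor_le (by positivity)
    have h2 : √(p : ℝ) ^ 4 = (p : ℝ) ^ 2 := by
      rw [show (4 : ℕ) = 2 * 2 by norm_num, pow_mul, Real.sq_sqrt (by positivity)]
    push_cast
    calc (L : ℝ) ^ 4 ≤ (200 * (√(p : ℝ) * Real.log p)) ^ 4 := by gcongr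
      _ = _ := by rw [mul_pow, mul_pow, h2]
  set P := (Nat.primesLE L).filter fun q => 23 < q with hP
  have hPc : Nat.primeCounting L ≤ P.card + 9 := by
    have h1 : ((Nat.primesLE L).filter fun q => ¬ 23 < q).card ≤ (Nat.primesLE 23).card := by
      apply Finset.card_le_card
      intro q hq
      simp only [Finset.mem_filter, Nat.mem_primesLE] at hq ⊢
      exact ⟨by omega, hq.1.2⟩
    have h2 : (Nat.primesLE 23).card = 9 := by decide
    have h3 : P.card + ((Nat.primesLE L).filter fun q => ¬ 23 < q).card = (Nat.primesLE L).card :=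
      Finset.card_filter_add_card_filter_not _
    have h4 : (Nat.primesLE L).card = Nat.primeCounting L := Nat.primesLE_card_eq_primeCounting L
    omega
  -- The `12` in the prime count pays for the nine primes up to `23` and for rounding up twice.
  have hk : 2 * ⌈40 * √(p : ℝ)⌉₊ ≤ P.card := by
    have h1 : (⌈40 * √(p : ℝ)⌉₊ : ℝ) < 40 * √(p : ℝ) + 1 := Nat.ceil_lt_add_one (by positivity)
    have h2 : (Nat.primeCounting L : ℝ) ≤ P.card + 9 := by exact_mod_cast hPc
    have : (2 * ⌈40 * √(p : ℝ)⌉₊ : ℝ) ≤ P.card := by linarith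
    exact_mod_cast this
  obtain ⟨Q, hQP, hQc⟩ := Finset.exists_subset_card_eq
    (show ⌈40 * √(p : ℝ)⌉₊ ≤ P.card by omega)
  have hu : Q ∪ P \ Q = P := Finset.union_sdiff_of_subset hQP
  have hcard : 3 * 22 ^ 2 * p ≤ Q.card * (P \ Q).card := by
    have h1 : ⌈40 * √(p : ℝ)⌉₊ ≤ (P \ Q).card := by
      rw [Finset.card_sdiff_of_subset hQP]; omega
    have h2 : 40 * √(p : ℝ) ≤ ⌈40 * √(p : ℝ)⌉₊ := Nat.le_ceil _
    -- The constant `40` is chosen because `40² = 1600 ≥ 3 · 22² = 1452`.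
    have h3 : (3 * 22 ^ 2 * p : ℝ) ≤ (⌈40 * √(p : ℝ)⌉₊ : ℝ) * ⌈40 * √(p : ℝ)⌉₊ := by
      calc (3 * 22 ^ 2 * p : ℝ) ≤ 1600 * p := by gcongr; norm_num
        _ = (40 * √(p : ℝ)) * (40 * √(p : ℝ)) := by
          rw [mul_mul_mul_comm, Real.mul_self_sqrt (by positivity)]; norm_num
        _ ≤ _ := by gcongr
    rw [hQc]
    refine le_trans ?_ (Nat.mul_le_mul_left _ h1)
    exact_mod_cast h3
  have hmem : ∀ q ∈ Q ∪ P \ Q, (q ≤ L ∧ q.Prime) ∧ 23 < q := by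
    intro q hq
    rwa [hu, hP, Finset.mem_filter, Nat.mem_primesLE] at hq
  obtain ⟨n, m, hnm, h⟩ := exists_tau_congruence hp (Q := Q) (R := P \ Q) (L := L)
    Finset.disjoint_sdiff (fun q hq => (hmem q hq).1.2) (fun q hq => (hmem q hq).1.1) hLp
    (fun q hq => (hmem q hq).2) hcard l
  refine ⟨n, m, hnm, fun i => ⟨(h i).1.1, (h i).2.1⟩, fun i => ⟨?_, ?_⟩, fun i => ?_⟩
  · exact le_trans (by exact_mod_cast (h i).1.2.1) hL4
  · exact le_trans (by exact_mod_cast (h i).2.2.1) hL4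
  · exact Nat.Coprime.mul_left (h i).1.2.2 (h i).2.2.2
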